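/- Let $k$ be an algebraically closed field of characteristic $0$, let $C$ be a smooth projective integral curve of genus $8$ over $k$ with canonical bundle $K_C$, let $\eta$ be a line bundle on $C$ with $\eta\not\cong\mathcal{O}_C$ and $\eta^{\otimes 2}\cong\mathcal{O}_C$, and put $L=K_C\otimes\eta$. Then $h^0(C,L)=7$. Assume that the complete linear system $|L|$ defines a closed embedding $\phi_L:C\hookrightarrow\mathbf{P}^6$ whose image is scheme-theoretically cut out by quadrics. Let $I_C(d)$ be the space of forms of degree $d$ on $\mathbf{P}^6$ that vanish on $C$, let $N_C^\vee$ be the conormal bundle of $\phi_L(C)$, and let $$F=\mathrm{Ker}\bigl\{I_C(2)\otimes\mathcal{O}_C\longrightarrow N_C^\vee\otimes L^{\otimes 2}\bigr\},$$ where the map is differentiation along $\phi_L(C)$. Write $F(L)=F\otimes L$; the inclusion of $F$ induces a map $H^0(C,F(L))\to I_C(2)\otimes H^0(C,L)$. Let $s\in H^0(C,F(L))$ be a section vanishing nowhere on $C$. It presents $F(L)$ as an extension $$0\longrightarrow\mathcal{O}_C\stackrel{s}{\longrightarrow}F(L)\stackrel{\pi}{\longrightarrow}K_C\otimes L^\vee\cong\eta\longrightarrow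 0;$$ let $e\in\mathrm{Ext}^1(\eta,\mathcal{O}_C)=H^1(C,L\otimes K_C^\vee)= H^0(C,K_C^{\otimes 2}\otimes L^\vee)^\vee= H^0(C,L)^\vee$ be its class, where the middle identification is Serre duality and the last one uses $\eta^{\otimes 2}\cong\mathcal{O}_C$: a section $\sigma\in H^0(C,L)=\mathrm{Hom}(\mathcal{O}_C,K_C\otimes\eta)$ is sent to the value of the trace on $\sigma\circ e\in\mathrm{Ext}^1(\eta,K_C\otimes\eta)=H^1(C,K_C)$. Let $\gamma=\sum_i\ell_i\otimes q_i\in\mathrm{Ker}\bigl\{H^0(C,L)\otimes I_C(2)\to I_C(3)\bigr\}$, with $(q_i)$ a basis of $I_C(2)$, where $H^0(C,L)=H^0(\mathbf{P}^6,\mathcal{O}(1))$, be a syzygy of rank $6$, that is, the $\ell_i$ span a subspace of dimension $6$ of $H^0(C,L)$. Let $f\in H^0(C,L)^\vee$ be a nonzero linear form that vanishes on this subspace; it is well defined up to a nonzero scalar. Assume that $s$ and $\gamma$ correspond to each other, in the sense that $h^0(C,F(L))=1$ or that $\gamma$ is a scalar multiple of the image of $s$ in $I_C(2)\otimes H^0(C,L)$.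 Then $e$ and $f$ are proportional: $e=c\,f$ for some $c\in k$. -/

import Mathlib

open CategoryTheory AlgebraicGeometry Limits Opposite
universe u
noncomputable section
namespace PrymSyzygy

section Mod
variable {X : Scheme.{u}}

/-- The structure sheaf as a module over itself. -/
abbrev 𝒪 (X : Scheme.{u}) : X.Modules := SheafOfModules.unit X.ringCatSheaf

instance : HasFiniteBiproducts X.Modules := Abelian.hasFiniteBiproducts
instance : HasExt.{u + 1} X.Modules := HasExt.standard _

/-- The value on `U` of a global section of `M`, written as a morphism `𝒪 ⟶ M`. -/
def ev {M : X.Modules} (s : 𝒪 X ⟶ M) (U : X.Opens) : Γ(M, U) := s.app U (1 : Γ(X, U))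

/-- The sheaf of modules associated with a presheaf of modules. -/
def sheafify (X : Scheme.{u}) : X.PresheafOfModules ⥤ X.Modules :=
  PresheafOfModules.sheafification (𝟙 X.ringCatSheaf.obj)

/-- The tensor product of two sheaves of modules: the sheaf associated with
`U ↦ Γ(M, U) ⊗ Γ(N, U)`. -/
def tensorObj (M N : X.Modules) : X.Modules :=
  (sheafify X).obj (PresheafOfModules.Monoidal.tensorObj (R := X.presheaf) M.val N.val)

/-- The tensor product of two morphisms. -/
def tensorMap {M M' N N' : X.Modules} (f : M ⟶ M') (g : N ⟶ N') : tensorObj M N ⟶ tensorObj M' N' :=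
  (sheafify X).map (PresheafOfModules.Monoidal.tensorHom (R := X.presheaf) f.val g.val)

/-- The morphism from a presheaf of modules to its associated sheaf. -/
def toSheafify (P : X.PresheafOfModules) : P ⟶ ((sheafify X).obj P).val :=
   (PresheafOfModules.sheafificationAdjunction (𝟙 X.ringCatSheaf.obj)).unit.app P

/-- The universal property of the associated sheaf. -/
def sheafifyDesc {P : X.PresheafOfModules} {M : X.Modules} (f : P ⟶ M.val) : (sheafify X).obj P ⟶ M :=
  ((PresheafOfModules.sheafificationAdjunction (𝟙 X.ringCatSheaf.obj)).homEquiv P M).symm f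

/-- The canonical isomorphism `𝒪 ⊗ M ⟶ M`. -/
def unitTensor (M : X.Modules) : tensorObj (𝒪 X) M ⟶ M :=
  sheafifyDesc (MonoidalCategoryStruct.leftUnitor (C := PresheafOfModules (X.presheaf ⋙ forget₂ CommRingCat RingCat)) M.val).hom

/-- The section `m ⊗ n` of `M ⊗ N`. -/
def tmul {M N : X.Modules} {U : X.Opens} (m : Γ(M, U)) (n : Γ(N, U)) : Γ(tensorObj M N, U) :=
  (toSheafify (PresheafOfModules.Monoidal.tensorObj (R := X.presheaf) M.val N.val)).app (op U) 
   (TensorProduct.tmul Γ(X, U) (M := Γ(M,U)) (N := Γ(N,U)) m n)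

lemma smul_tmul {M N : X.Modules} {U : X.Opens} (a : Γ(X, U)) (m : Γ(M, U)) (n : Γ(N, U)) :
    tmul (a • m) n = tmul m (a • n) := by
  unfold tmul
  congr 1
  exact TensorProduct.smul_tmul a m n

lemma tmul_res {M N : X.Modules} {U V : X.Opens} (i : V ⟶ U) (m : Γ(M, U)) (n : Γ(N, U)) :
    (tensorObj M N).presheaf.map i.op (tmul m n) =
      tmul (M.presheaf.map i.op m) (N.presheaf.map i.op n) := by
  exact (PresheafOfModules.naturality_apply (toSheafify
    (PresheafOfModules.Monoidal.tensorObj (R := X.presheaf) M.val N.val)) i.op _).symm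

/-- Multiplication by a global function as an endomorphism of a module. -/
def scalarEnd (r : Γ(X, ⊤)) (M : X.Modules) : M ⟶ M :=
  ⟨PresheafOfModules.homMk
    { app := fun U ↦ AddCommGrpCat.ofHom
        (DistribSMul.toAddMonoidHom Γ(M, U.unop)
          (X.presheaf.map (homOfLE le_top).op r : Γ(X, U.unop)))
      naturality := by
        intro U V f
        ext m
        have := M.map_smul f.unop (X.presheaf.map (homOfLE le_top).op r) m
        rw [← ConcreteCategory.comp_apply (X.presheaf.map _), ← X.presheaf.map_comp] at this
        exact this.symm }
    (by
      intro U a m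
      exact smul_comm (M := Γ(X, U.unop)) (N := Γ(X, U.unop)) (α := Γ(M, U.unop)) _ a m)⟩

lemma scalarEnd_app (r : Γ(X, ⊤)) (M : X.Modules) (U : X.Opens) (m : Γ(M, U)) :
    (scalarEnd r M).app U m = (X.presheaf.map (homOfLE le_top).op r : Γ(X, U)) • m := rfl

/-- Global functions act on the category of modules. -/
def centralAction : Γ(X, ⊤) →+* CatCenter X.Modules where
  toFun r :=
    { app M := scalarEnd r M
      naturality M N f := by
        ext U m
        change (scalarEnd r N).app U (f.app U m) = f.app U ((scalarEnd r M).app U m)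
        rw [scalarEnd_app, scalarEnd_app]
        exact (f.app_smul _ m).symm }
  map_one' := by
    ext M U m
    change (scalarEnd 1 M).app U m = m
    rw [scalarEnd_app, map_one, one_smul]
  map_mul' a b := by
    ext M U m
    change (scalarEnd (a * b) M).app U m = (scalarEnd a M).app U ((scalarEnd b M).app U m)
    simp only [scalarEnd_app, map_mul, mul_smul]
  map_zero' := by
    ext M U m
    change (scalarEnd 0 M).app U m = 0
    rw [scalarEnd_app, map_zero, zero_smul]
  map_add' a b := by
    ext M U m
    change (scalarEnd (a + b) M).app U m = (scalarEnd a M).app U m + (scalarEnd b M).app U m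
    simp only [scalarEnd_app, map_add, add_smul]

lemma existsUnique_kernel_section {M N : X.Modules} (f : M ⟶ N) (U : X.Opens) (x : Γ(M, U))
    (hx : f.app U x = 0) : ∃! y : Γ(kernel f, U), (kernel.ι f).app U y = x := by
  let G : X.Modules ⥤ AddCommGrpCat.{u} :=
    Scheme.Modules.toPresheaf X ⋙ (evaluation _ _).obj (op U)
  have h1 : PreservesFiniteLimits (Scheme.Modules.toPresheaf X) := inferInstance
  have h2 : PreservesFiniteLimits ((evaluation (TopologicalSpace.Opens X)ᵒᵖ AddCommGrpCat.{u}).obj (op U)) := inferInstance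
  have h3 : PreservesFiniteLimits G := comp_preservesFiniteLimits _ _
  have h4 : G.PreservesZeroMorphisms := ⟨fun _ _ ↦ rfl⟩
  let S : ShortComplex X.Modules := ShortComplex.mk (kernel.ι f) f (kernel.condition f)
  have hS : S.Exact := S.exact_of_f_is_kernel (kernelIsKernel f)
  have hm : Mono S.f := inferInstanceAs (Mono (kernel.ι f))
  have hm' : Mono (S.map G).f := inferInstanceAs (Mono (G.map S.f))
  have hE : (S.map G).Exact := hS.map_of_mono_of_preservesKernel G hm inferInstance
  obtain ⟨y, hy⟩ := (ShortComplex.ab_exact_iff _).1 hE x hx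
  have hinj := (AddCommGrpCat.mono_iff_injective _).1 hm'
  exact ⟨y, hy, fun z hz ↦ hinj (hz.trans hy.symm)⟩

/-- The section `g` trivialises `M` on `U`. -/
def IsGenerator (M : X.Modules) (U : X.Opens) (g : Γ(M, U)) : Prop :=
  ∀ (V : X.Opens) (i : V ⟶ U), Function.Bijective fun a : Γ(X, V) ↦ a • M.presheaf.map i.op g

/-- `M` is an invertible sheaf. -/
def IsLineBundle (M : X.Modules) : Prop :=
  ∀ x : X, ∃ (U : X.Opens) (_ : x ∈ U) (g : Γ(M, U)), IsGenerator M U g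

/-- The functions on `U` that vanish at `x`. -/
def idealAt (U : X.Opens) (x : X) (hx : x ∈ U) : Ideal Γ(X, U) :=
  (IsLocalRing.maximalIdeal (X.presheaf.stalk x)).comap (X.presheaf.germ U x hx).hom

/-- The section `s` of `M` vanishes at `x`: near `x` it lies in `𝔪ₓ M`. -/
def VanishesAt {M : X.Modules} (s : 𝒪 X ⟶ M) (x : X) : Prop :=
  ∃ (U : X.Opens) (hx : x ∈ U), ev s U ∈ idealAt U x hx • (⊤ : Submodule Γ(X, U) Γ(M, U))

/-- The section `s` vanishes nowhere. -/
def IsNowhereVanishing {M : X.Modules} (s : 𝒪 X ⟶ M) : Prop := ∀ x : X, ¬ VanishesAt s x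

lemma smul_tmul' {M N : X.Modules} {U : X.Opens} (a : Γ(X, U)) (m : Γ(M, U)) (n : Γ(N, U)) :
    tmul (a • m) n = a • tmul m n := by
  unfold tmul
  exact ((toSheafify (PresheafOfModules.Monoidal.tensorObj (R := X.presheaf) M.val N.val)).app
    (op U)).hom.map_smul a (TensorProduct.tmul Γ(X, U) (M := Γ(M, U)) (N := Γ(N, U)) m n)

lemma exists_ev_eq (M : X.Modules) (m : Γ(M, ⊤)) :
    ∃ s : 𝒪 X ⟶ M, ∀ U : X.Opens, ev s U = M.presheaf.map (homOfLE le_top).op m := by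
  let σ : SheafOfModules.sections (R := X.ringCatSheaf) M := PresheafOfModules.sectionsMk
    (fun U ↦ M.presheaf.map (homOfLE (le_top : U.unop ≤ ⊤)).op m) (by
      intro U V f
      exact congr($((M.presheaf.map_comp _ f).symm) m))
  refine ⟨(SheafOfModules.unitHomEquiv (R := X.ringCatSheaf) M).symm σ, fun U ↦ ?_⟩
  have := (SheafOfModules.unitHomEquiv (R := X.ringCatSheaf) M).apply_symm_apply σ
  exact congr(($this).val (op U))

lemma exists_glue {ι : Type*} (M : X.Modules) (U : ι → X.Opens) (hU : ⨆ i, U i = ⊤)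
    (m : ∀ i, Γ(M, U i))
    (hm : ∀ i j, M.presheaf.map (homOfLE (inf_le_left : U i ⊓ U j ≤ U i)).op (m i) =
      M.presheaf.map (homOfLE (inf_le_right : U i ⊓ U j ≤ U j)).op (m j)) :
    ∃ s : 𝒪 X ⟶ M, ∀ i, ev s (U i) = m i := by
  obtain ⟨g, hg, -⟩ := TopCat.Sheaf.existsUnique_gluing' (⟨M.presheaf, M.isSheaf⟩ : TopCat.Sheaf Ab X)
    U ⊤ (fun i ↦ homOfLE le_top) hU.ge m hm
  obtain ⟨s, hs⟩ := exists_ev_eq M g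
  exact ⟨s, fun i ↦ (hs _).trans (hg i)⟩

variable {Y : Scheme.{u}} (φ : X ⟶ Y)

/-- The comorphism `𝒪_Y ⟶ φ_* 𝒪_X`. -/
def unitToPushforward : 𝒪 Y ⟶ (Scheme.Modules.pushforward φ).obj (𝒪 X) :=
  SheafOfModules.unitToPushforwardObjUnit φ.toRingCatSheafHom

lemma unitToPushforward_app (U : Y.Opens) (a : Γ(Y, U)) :
    (unitToPushforward φ).app U a = (φ.app U a : Γ(X, φ ⁻¹ᵁ U)) := rfl

/-- The ideal sheaf of `φ`. -/
def idealSheaf : Y.Modules := kernel (unitToPushforward φ)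

/-- The inclusion of the ideal sheaf of `φ` in `𝒪_Y`. -/
def idealSheafι : idealSheaf φ ⟶ 𝒪 Y := kernel.ι (unitToPushforward φ)

/-- The conormal sheaf `N^∨ = φ^* I = I / I²` of a closed immersion `φ` with ideal sheaf `I`. -/
def conormal : X.Modules := (Scheme.Modules.pullback φ).obj (idealSheaf φ)

/-- A function on `U` that pulls back to zero, as a section of the ideal sheaf. -/
def idealSheafSection (U : Y.Opens) (a : Γ(Y, U)) (ha : φ.app U a = 0) : Γ(idealSheaf φ, U) :=
  (existsUnique_kernel_section (unitToPushforward φ) U a ha).choose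

lemma idealSheafSection_spec (U : Y.Opens) (a : Γ(Y, U)) (ha : φ.app U a = 0) :
    (idealSheafι φ).app U (idealSheafSection φ U a ha) = a :=
  (existsUnique_kernel_section (unitToPushforward φ) U a ha).choose_spec.1

lemma idealSheafSection_eq {U : Y.Opens} {a : Γ(Y, U)} (ha : φ.app U a = 0) (y : Γ(idealSheaf φ, U))
    (hy : (idealSheafι φ).app U y = a) : idealSheafSection φ U a ha = y :=
  ((existsUnique_kernel_section (unitToPushforward φ) U a ha).choose_spec.2 y hy).symm

/-- The class in `N^∨` of a function `a` on `U` that pulls back to zero; that is, its differential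
along `φ`. -/
def conormalClass (U : Y.Opens) (a : Γ(Y, U)) (ha : φ.app U a = 0) : Γ(conormal φ, φ ⁻¹ᵁ U) :=
  ((Scheme.Modules.pullbackPushforwardAdjunction φ).unit.app (idealSheaf φ)).app U
    (idealSheafSection φ U a ha)

lemma conormalClass_mul (U : Y.Opens) (b a : Γ(Y, U)) (ha : φ.app U a = 0) :
    conormalClass φ U (b * a) (by rw [map_mul, ha, mul_zero]) =
      (φ.app U b : Γ(X, φ ⁻¹ᵁ U)) • conormalClass φ U a ha := by
  have : idealSheafSection φ U (b * a) (by rw [map_mul, ha, mul_zero]) =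
      b • idealSheafSection φ U a ha := by
    apply idealSheafSection_eq
    exact ((idealSheafι φ).app_smul b _).trans (congr_arg (b • ·) (idealSheafSection_spec φ U a ha))
  unfold conormalClass
  rw [this, Scheme.Modules.Hom.app_smul]
  rfl

lemma conormalClass_res {U V : Y.Opens} (h : V ≤ U) (a : Γ(Y, U)) (ha : φ.app U a = 0)
    (ha' : φ.app V (Y.presheaf.map (homOfLE h).op a) = 0) :
    (conormal φ).presheaf.map (homOfLE (fun _ hx ↦ h hx : φ ⁻¹ᵁ V ≤ φ ⁻¹ᵁ U)).op
      (conormalClass φ U a ha) = conormalClass φ V (Y.presheaf.map (homOfLE h).op a) ha' := by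
  have : idealSheafSection φ V (Y.presheaf.map (homOfLE h).op a) ha' =
      (idealSheaf φ).presheaf.map (homOfLE h).op (idealSheafSection φ U a ha) := by
    apply idealSheafSection_eq
    have := congr($((idealSheafι φ).mapPresheaf.naturality (homOfLE h).op)
      (idealSheafSection φ U a ha))
    refine Eq.trans this ?_
    change (𝒪 Y).presheaf.map (homOfLE h).op
      ((idealSheafι φ).app U (idealSheafSection φ U a ha)) = _
    rw [idealSheafSection_spec]
    rfl
  unfold conormalClass
  rw [this]
  exact congr($(((Scheme.Modules.pullbackPushforwardAdjunction φ).unit.app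
    (idealSheaf φ)).mapPresheaf.naturality (homOfLE h).op) (idealSheafSection φ U a ha)).symm

end Mod

section OverField

variable (k : Type u) [Field k] (X : Scheme.{u}) [X.Over (Spec (CommRingCat.of k))]
/-- The constant functions on `U`. -/
def constants (U : X.Opens) : k →+* Γ(X, U) :=
  ((Scheme.ΓSpecIso (CommRingCat.of k)).inv ≫ (X ↘ Spec (CommRingCat.of k)).appTop ≫
    X.presheaf.map (homOfLE le_top).op).hom

/-- The `k`-linear structure on the modules over a `k`-scheme; in particular `H⁰(M) = (𝒪 X ⟶ M)`
and the groups `Ext` are vector spaces over `k`. -/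
instance : Linear k X.Modules := Linear.ofRingMorphism (centralAction.comp (constants k X ⊤))

/-- The inclusion of the constant functions in the structure presheaf. -/
def constantsHom : (Functor.const _).obj (CommRingCat.of k) ⟶ X.presheaf where
  app U := CommRingCat.ofHom (constants k X U.unop)
  naturality U V f := by
    ext a
    simp only [constants, CommRingCat.ofHom_hom]
    rw [Category.assoc, Category.assoc, ← X.presheaf.map_comp]
    rfl

/-- The sheaf of relative differentials of `X` over `k`. On a smooth curve this is the canonical
bundle. -/
def Omega : X.Modules := (sheafify X).obj (PresheafOfModules.DifferentialsConstruction.relativeDifferentials' (constantsHom k X))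

end OverField

section Proj6

variable (k : Type u) [Field k]
instance : GradedAlgebra (MvPolynomial.homogeneousSubmodule (Fin 7) k) := MvPolynomial.gradedAlgebra
/-- Projective space of dimension `6` over `k`. -/
abbrev PP : Scheme.{u} := Proj (MvPolynomial.homogeneousSubmodule (Fin 7) k)

/-- The structure morphism of projective space. -/
def PP.str : PP k ⟶ Spec (CommRingCat.of k) :=
  Proj.toSpecZero (MvPolynomial.homogeneousSubmodule (Fin 7) k) ≫
    Spec.map (CommRingCat.ofHom (algebraMap k (MvPolynomial.homogeneousSubmodule (Fin 7) k 0)))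
/-- The open set where `X_j` is nonzero. -/
abbrev chart (j : Fin 7) : (PP k).Opens := Proj.basicOpen (MvPolynomial.homogeneousSubmodule (Fin 7) k) (MvPolynomial.X j)

/-- The function `q / X_j ^ d` on the chart `X_j ≠ 0`, for a form `q` of degree `d`. -/
def frac (d : ℕ) (j : Fin 7) (q : MvPolynomial.homogeneousSubmodule (Fin 7) k d) : Γ(PP k, chart k j) :=
  Proj.awayToSection (MvPolynomial.homogeneousSubmodule (Fin 7) k) (MvPolynomial.X j)
   (HomogeneousLocalization.Away.mk _ (MvPolynomial.isHomogeneous_X k j) d q.1 (by simp))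

variable {k}

open MvPolynomial HomogeneousLocalization in
lemma away_val (j : Fin 7) (d : ℕ) (q : MvPolynomial (Fin 7) k) (hq) :
    (Away.mk (homogeneousSubmodule (Fin 7) k) (isHomogeneous_X k j) d q hq).val =
      Localization.mk q (⟨X j ^ d, d, rfl⟩ : Submonoid.powers (X j)) :=
  rfl

lemma frac_add (d : ℕ) (j : Fin 7) (p q : MvPolynomial.homogeneousSubmodule (Fin 7) k d) :
    frac k d j (p + q) = frac k d j p + frac k d j q := by
  unfold frac
  rw [← map_add]
  congr 1
  apply HomogeneousLocalization.val_injective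
  rw [HomogeneousLocalization.val_add, away_val, away_val, away_val, Localization.add_mk_self]
  rfl

lemma frac_smul (d : ℕ) (j : Fin 7) (a : k) (q : MvPolynomial.homogeneousSubmodule (Fin 7) k d) :
    frac k d j (a • q) =
      frac k 0 j ⟨MvPolynomial.C a, MvPolynomial.isHomogeneous_C _ a⟩ * frac k d j q := by
  unfold frac
  rw [← map_mul]
  congr 1
  apply HomogeneousLocalization.val_injective
  rw [HomogeneousLocalization.val_mul, away_val, away_val, away_val, Localization.mk_mul]
  congr 1
  · exact MvPolynomial.smul_eq_C_mul _ _
  · exact Subtype.ext (by simp)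

open MvPolynomial in
lemma frac_overlap (j m : Fin 7) (q : homogeneousSubmodule (Fin 7) k 2) :
    (PP k).presheaf.map (homOfLE inf_le_left : chart k j ⊓ chart k m ⟶ chart k j).op (frac k 2 j q) =
      (PP k).presheaf.map (homOfLE inf_le_left : chart k j ⊓ chart k m ⟶ chart k j).op
        (frac k 1 j ⟨X m, isHomogeneous_X k m⟩) ^ 2 *
      (PP k).presheaf.map (homOfLE inf_le_right : chart k j ⊓ chart k m ⟶ chart k m).op
        (frac k 2 m q) := by
  suffices H : ∀ (U : (PP k).Opens) (hU : U = Proj.basicOpen _ (X j * X m))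
      (h1 : U ≤ chart k j) (h2 : U ≤ chart k m),
      (PP k).presheaf.map (homOfLE h1).op (frac k 2 j q) =
      (PP k).presheaf.map (homOfLE h1).op (frac k 1 j ⟨X m, isHomogeneous_X k m⟩) ^ 2 *
      (PP k).presheaf.map (homOfLE h2).op (frac k 2 m q) from
    H _ (Proj.basicOpen_mul _ _ _).symm _ _
  rintro U rfl h1 h2
  have key1 (d : ℕ) (p : homogeneousSubmodule (Fin 7) k d) :=
    ConcreteCategory.congr_hom (Proj.awayMap_awayToSection (homogeneousSubmodule (Fin 7) k)
      (f := X j) (isHomogeneous_X k m) (rfl : X j * X m = X j * X m))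
      (HomogeneousLocalization.Away.mk _ (isHomogeneous_X k j) d p.1 (by simp))
  have key2 (p : homogeneousSubmodule (Fin 7) k 2) :=
    ConcreteCategory.congr_hom (Proj.awayMap_awayToSection (homogeneousSubmodule (Fin 7) k)
      (f := X m) (isHomogeneous_X k j) (mul_comm (X j) (X m)))
      (HomogeneousLocalization.Away.mk _ (isHomogeneous_X k m) 2 p.1 (by simp))
  have e1 := key1 2 q
  have e2 := key1 1 ⟨X m, isHomogeneous_X k m⟩
  have e3 := key2 q
  refine e1.symm.trans ((?_ : _ = _).trans (congr($e2 ^ 2 * $e3)))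
  simp only [CommRingCat.hom_comp, RingHom.comp_apply, CommRingCat.hom_ofHom]
  rw [← map_pow, ← map_mul]
  congr 1
  apply HomogeneousLocalization.val_injective
  rw [HomogeneousLocalization.val_mul, HomogeneousLocalization.val_pow]
  erw [HomogeneousLocalization.awayMap_mk, HomogeneousLocalization.awayMap_mk,
    HomogeneousLocalization.awayMap_mk]
  simp only [HomogeneousLocalization.Away.val_mk, Localization.mk_pow, Localization.mk_mul]
  refine Localization.mk_eq_mk_iff.mpr ?_
  rw [Localization.r_iff_exists]
  refine ⟨1, ?_⟩
  simp
  ring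

open MvPolynomial in
lemma iSup_chart : ⨆ j, chart k j = ⊤ := by
  apply Proj.iSup_basicOpen_eq_top'
  · exact fun j ↦ ⟨1, isHomogeneous_X k j⟩
  · rw [← top_le_iff]
    intro p _
    have hp : p ∈ Algebra.adjoin k (Set.range (X : Fin 7 → MvPolynomial (Fin 7) k)) := by
      rw [adjoin_range_X]; trivial
    induction hp using Algebra.adjoin_induction with
    | mem x hx => exact Algebra.subset_adjoin hx
    | algebraMap r =>
      exact Subalgebra.algebraMap_mem _ (⟨C r, isHomogeneous_C _ r⟩ : homogeneousSubmodule (Fin 7) k 0)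
    | add x y _ _ hx hy => exact add_mem (hx trivial) (hy trivial)
    | mul x y _ _ hx hy => exact mul_mem (hx trivial) (hy trivial)

end Proj6

section Curve

variable {k : Type u} [Field k] {C : Scheme.{u}} [C.Over (Spec (CommRingCat.of k))]

/-- The coordinate `X_l` as a form of degree one. -/
abbrev coord (l : Fin 7) : MvPolynomial.homogeneousSubmodule (Fin 7) k 1 :=
  ⟨MvPolynomial.X l, MvPolynomial.isHomogeneous_X k l⟩

/-- `φ` is the morphism `[x_0 : ... : x_6]` over `k` attached to the sections `x_l` of `L`, which are
in particular without common zero: the preimage of the chart `X_j ≠ 0` is contained in the locus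
where `x_j` generates `L`, and there `X_l / X_j` pulls back to `x_l / x_j`. -/
structure IsLinearSystemMap {L : C.Modules} (x : Fin 7 → (𝒪 C ⟶ L)) (φ : C ⟶ PP k) : Prop where
  comp_str : φ ≫ PP.str k = C ↘ Spec (CommRingCat.of k)
  isGenerator (j : Fin 7) : IsGenerator L (φ ⁻¹ᵁ chart k j) (ev (x j) _)
  ratio (j l : Fin 7) : ev (x l) (φ ⁻¹ᵁ chart k j) =
    (φ.app (chart k j) (frac k 1 j (coord l)) : Γ(C, φ ⁻¹ᵁ chart k j)) • ev (x j) _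

/-- The space `I_C(d)` of forms of degree `d` that vanish on `C`. -/
def vanishingForms (φ : C ⟶ PP k) (d : ℕ) : Submodule k (MvPolynomial (Fin 7) k) where
  carrier := {q | ∃ hq : q ∈ MvPolynomial.homogeneousSubmodule (Fin 7) k d,
    ∀ j, φ.app (chart k j) (frac k d j ⟨q, hq⟩) = 0}
  zero_mem' := ⟨zero_mem _, fun j ↦ by
    have := frac_smul d j (0 : k) 0
    rw [zero_smul] at this
    have h0 : frac k d j 0 = 0 := by
      have := frac_add (k := k) d j 0 0
      rw [add_zero] at this
      exact left_eq_add.mp this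
    exact (congr_arg _ h0).trans (map_zero _)⟩
  add_mem' := by
    rintro p q ⟨hp, hp'⟩ ⟨hq, hq'⟩
    refine ⟨add_mem hp hq, fun j ↦ ?_⟩
    rw [show (⟨p + q, add_mem hp hq⟩ : MvPolynomial.homogeneousSubmodule (Fin 7) k d) =
      ⟨p, hp⟩ + ⟨q, hq⟩ from rfl, frac_add, map_add, hp', hq', add_zero]
  smul_mem' := by
    rintro a q ⟨hq, hq'⟩
    refine ⟨Submodule.smul_mem _ a hq, fun j ↦ ?_⟩
    rw [show (⟨a • q, Submodule.smul_mem _ a hq⟩ : MvPolynomial.homogeneousSubmodule (Fin 7) k d) =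
      a • ⟨q, hq⟩ from rfl, frac_smul, map_mul, hq', mul_zero]

/-- The local equation `q / X_j ^ d` of a form `q` in `I_C(d)`. -/
def equation {φ : C ⟶ PP k} {d : ℕ} (q : vanishingForms φ d) (j : Fin 7) : Γ(PP k, chart k j) :=
  frac k d j ⟨q.1, q.2.choose⟩

lemma app_equation {φ : C ⟶ PP k} {d : ℕ} (q : vanishingForms φ d) (j : Fin 7) :
    φ.app (chart k j) (equation q j) = 0 := q.2.choose_spec j

/-- The image of `φ` is cut out scheme-theoretically by quadrics: on every chart its ideal is generated
by the equations of the quadrics that contain it. -/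
def IsCutOutByQuadrics (φ : C ⟶ PP k) : Prop :=
  ∀ j, RingHom.ker (φ.app (chart k j)).hom = Ideal.span (Set.range fun q : vanishingForms φ 2 ↦ equation q j)

/-- The sheaf `N_C^∨ ⊗ L^{⊗ 2}`. -/
def conormalL2 (φ : C ⟶ PP k) (L : C.Modules) : C.Modules := tensorObj (conormal φ) (tensorObj L L)

/-- The differential of the quadric `q` along `C` on the chart `X_j ≠ 0`, namely
`[q / X_j²] ⊗ x_j ⊗ x_j`. -/
def localDiff {φ : C ⟶ PP k} {L : C.Modules} (x : Fin 7 → (𝒪 C ⟶ L)) (q : vanishingForms φ 2) (j : Fin 7) :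
    Γ(conormalL2 φ L, φ ⁻¹ᵁ chart k j) :=
  tmul (conormalClass φ (chart k j) (equation q j) (app_equation q j))
    (tmul (ev (x j) _) (ev (x j) _))

lemma ev_res {M : C.Modules} (s : 𝒪 C ⟶ M) {U V : C.Opens} (h : V ≤ U) :
    M.presheaf.map (homOfLE h).op (ev s U) = ev s V := by
  have := congr($(s.mapPresheaf.naturality (homOfLE h).op) (1 : Γ(C, U)))
  refine Eq.trans this.symm ?_
  change s.app V (C.presheaf.map (homOfLE h).op (1 : Γ(C, U))) = _
  rw [map_one]
  rfl

lemma exists_conormalDiff {φ : C ⟶ PP k} {L : C.Modules} {x : Fin 7 → (𝒪 C ⟶ L)}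
    (h : IsLinearSystemMap x φ) (q : vanishingForms φ 2) :
    ∃ dq : 𝒪 C ⟶ conormalL2 φ L, ∀ j, ev dq (φ ⁻¹ᵁ chart k j) = localDiff x q j := by
  apply exists_glue
  · rw [← Scheme.Hom.preimage_iSup, iSup_chart]
    rfl
  intro j m
  set V : (PP k).Opens := chart k j ⊓ chart k m with hV
  have hj : V ≤ chart k j := inf_le_left
  have hm : V ≤ chart k m := inf_le_right
  have hj' : φ ⁻¹ᵁ V ≤ φ ⁻¹ᵁ chart k j := fun _ hx ↦ hj hx
  have hm' : φ ⁻¹ᵁ V ≤ φ ⁻¹ᵁ chart k m := fun _ hx ↦ hm hx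
  have hres {U : (PP k).Opens} (hU : V ≤ U) (b : Γ(PP k, U)) :
      φ.app V ((PP k).presheaf.map (homOfLE hU).op b) =
        C.presheaf.map (homOfLE (fun _ hx ↦ hU hx : φ ⁻¹ᵁ V ≤ φ ⁻¹ᵁ U)).op (φ.app U b) :=
    congr($(φ.naturality (homOfLE hU).op) b)
  have hzj : φ.app V ((PP k).presheaf.map (homOfLE hj).op (equation q j)) = 0 := by
    rw [hres, app_equation, map_zero]
  have hzm : φ.app V ((PP k).presheaf.map (homOfLE hm).op (equation q m)) = 0 := by
    rw [hres, app_equation, map_zero]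
  set b := (PP k).presheaf.map (homOfLE hj).op (frac k 1 j (coord m)) with hb
  have hover : (PP k).presheaf.map (homOfLE hj).op (equation q j) =
      b ^ 2 * (PP k).presheaf.map (homOfLE hm).op (equation q m) := frac_overlap j m _
  have hcl : conormalClass φ V _ hzj = (φ.app V b : Γ(C, φ ⁻¹ᵁ V)) ^ 2 • conormalClass φ V _ hzm := by
    rw [← map_pow, ← conormalClass_mul]
    congr 1
  have hx : ev (x m) (φ ⁻¹ᵁ V) = (φ.app V b : Γ(C, φ ⁻¹ᵁ V)) • ev (x j) (φ ⁻¹ᵁ V) := by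
    have := congr_arg (L.presheaf.map (homOfLE hj').op) (h.ratio j m)
    rw [Scheme.Modules.map_smul, ev_res, ev_res] at this
    rw [this, hb, hres]
  have hsq (a : Γ(C, φ ⁻¹ᵁ V)) (y : Γ(L, φ ⁻¹ᵁ V)) : tmul (a • y) (a • y) = a ^ 2 • tmul y y := by
    rw [smul_tmul', ← smul_tmul, smul_tmul', smul_smul, pow_two]
  change (conormalL2 φ L).presheaf.map (homOfLE hj').op (localDiff x q j) =
    (conormalL2 φ L).presheaf.map (homOfLE hm').op (localDiff x q m)
  unfold localDiff conormalL2
  rw [tmul_res, tmul_res, tmul_res, tmul_res, ev_res, ev_res, conormalClass_res φ hj _ _ hzj,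
    conormalClass_res φ hm _ _ hzm, hcl, hx, hsq, smul_tmul]

/-- The differential along `C` of a quadric `q` in `I_C(2)`: the global section of `N_C^∨ ⊗ L^{⊗ 2}`
equal to `[q / X_j²] ⊗ x_j ⊗ x_j` on every chart. -/
def conormalDiff {φ : C ⟶ PP k} {L : C.Modules} {x : Fin 7 → (𝒪 C ⟶ L)}
    (h : IsLinearSystemMap x φ) (q : vanishingForms φ 2) : 𝒪 C ⟶ conormalL2 φ L :=
  (exists_conormalDiff h q).choose

lemma conormalDiff_spec {φ : C ⟶ PP k} {L : C.Modules} {x : Fin 7 → (𝒪 C ⟶ L)}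
    (h : IsLinearSystemMap x φ) (q : vanishingForms φ 2) (j : Fin 7) :
    ev (conormalDiff h q) (φ ⁻¹ᵁ chart k j) = localDiff x q j :=
  (exists_conormalDiff h q).choose_spec j

/-- The morphism `I_C(2) ⊗ 𝒪_C ⟶ N_C^∨ ⊗ L^{⊗ 2}` of differentiation along `C`, written in a basis `q`
of `I_C(2)`. -/
def differentiation {φ : C ⟶ PP k} {L : C.Modules} {x : Fin 7 → (𝒪 C ⟶ L)}
    (h : IsLinearSystemMap x φ) {n : ℕ} (q : Fin n → vanishingForms φ 2) :
    (⨁ fun _ : Fin n ↦ 𝒪 C) ⟶ conormalL2 φ L :=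
  biproduct.desc fun i ↦ conormalDiff h (q i)

/-- The sheaf `F`: the kernel of `I_C(2) ⊗ 𝒪_C ⟶ N_C^∨ ⊗ L^{⊗ 2}`. -/
def bundleF {φ : C ⟶ PP k} {L : C.Modules} {x : Fin 7 → (𝒪 C ⟶ L)}
    (h : IsLinearSystemMap x φ) {n : ℕ} (q : Fin n → vanishingForms φ 2) : C.Modules :=
  kernel (differentiation h q)

/-- The components `s_i` of a section `s` of `F(L) = F ⊗ L` under `H⁰(F(L)) ⟶ I_C(2) ⊗ H⁰(L)`, that is,
`s ↦ ∑ q_i ⊗ s_i`. -/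
def component {φ : C ⟶ PP k} {L : C.Modules} {x : Fin 7 → (𝒪 C ⟶ L)}
    (h : IsLinearSystemMap x φ) {n : ℕ} (q : Fin n → vanishingForms φ 2)
    (s : 𝒪 C ⟶ tensorObj (bundleF h q) L) (i : Fin n) : 𝒪 C ⟶ L :=
  s ≫ tensorMap (kernel.ι (differentiation h q) ≫ biproduct.π _ i) (𝟙 L) ≫ unitTensor L

/-- The linear form on projective space that restricts to the section `σ` of `L`. -/
def linearForm {L : C.Modules} (x : Module.Basis (Fin 7) k (𝒪 C ⟶ L)) (σ : 𝒪 C ⟶ L) :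
    MvPolynomial (Fin 7) k :=
  ∑ l, x.repr σ l • MvPolynomial.X l

/-- The functional `σ ↦ tr (σ ∘ e)` on `H⁰(L)` attached to `e` in `Ext¹(A, 𝒪)`, where the Yoneda
product `σ ∘ e` lies in `Ext¹(A, L)`. For `L = A ⊗ K` on a curve with canonical bundle `K`,
`Ext¹(A, L) = H¹(K)` and `tr` the trace, this is the image of `e` under the Serre duality
`H¹(A^∨) = H⁰(A ⊗ K)^∨`. -/
def serrePairing {A L : C.Modules} (tr : Abelian.Ext A L 1 →ₗ[k] k) (e : Abelian.Ext A (𝒪 C) 1) :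
    (𝒪 C ⟶ L) →ₗ[k] k where
  toFun σ := tr (e.comp (Abelian.Ext.mk₀ σ) (add_zero 1))
  map_add' σ τ := by
    rw [Abelian.Ext.mk₀_add, Abelian.Ext.comp_add, map_add]
  map_smul' a σ := by
    rw [Abelian.Ext.mk₀_smul, Abelian.Ext.comp_smul, map_smul, RingHom.id_apply]

end Curve
end PrymSyzygy

end

open PrymSyzygy

noncomputable section
namespace PrymSyzygy

/-! ### Sections of sheaves of modules: values on opens, free modules, kernels. -/

section Sections
variable {X : Scheme.{u}}

/-! Pushing an extension out along its own inclusion `s` splits it, so `e` composed with `s` is zero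
in `Ext¹(η, F(L))`. Each coordinate `s_i` of `s` in `I_C(2) ⊗ H⁰(L)` is `s` followed by a morphism
`F(L) ⟶ L`; hence `s_i ∘ e = 0`, and the functional attached to `e` kills every `s_i`
(`serrePairing_extClass_comp`). If `ℓ_i = a s_i` for all `i`, it kills the span of the `ℓ_i`. That
span has dimension 6 in the 7-dimensional `H⁰(L)`, so it is the kernel of `f`, and the functional is
a multiple of `f` (`exists_eq_smul_of_finrank_span`). The multiple may be zero.

When only `h⁰(F(L)) = 1` is known, the syzygy must first be realised as a section of `F(L)`
(`exists_section_of_syzygy`). Differentiating `∑ ℓ_i q_i = 0` along `C` gives `∑ ℓ_i dq_i = 0`,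
because the terms `q_i dℓ_i` vanish on `C`. So the `ℓ_i` define local sections of `F` on the charts
of projective space; twisted by `L`, these glue. Since `s ≠ 0`, the glued section is a multiple of
`s`. -/

lemma tensorMap_tmul {M M' N N' : X.Modules} (f : M ⟶ M') (g : N ⟶ N') {U : X.Opens}
    (m : Γ(M, U)) (n : Γ(N, U)) :
    (tensorMap f g).app U (tmul m n) = tmul (f.app U m) (g.app U n) := by
  have := (PresheafOfModules.sheafificationAdjunction (𝟙 X.ringCatSheaf.obj)).unit.naturality
    (PresheafOfModules.Monoidal.tensorHom (R := X.presheaf) f.val g.val)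
  exact congr(($this).app (op U)
    (TensorProduct.tmul Γ(X, U) (M := Γ(M, U)) (N := Γ(N, U)) m n)).symm

/-- A morphism out of an associated sheaf, composed with the unit of the adjunction, is the presheaf
morphism that it came from; here that is the left unitor. -/
lemma unitTensor_tmul (M : X.Modules) {U : X.Opens} (a : Γ(X, U)) (m : Γ(M, U)) :
    (unitTensor M).app U (tmul (M := 𝒪 X) a m) = a • m := by
  have := (PresheafOfModules.sheafificationAdjunction (𝟙 X.ringCatSheaf.obj)).homEquiv_unit
    (f := unitTensor M)
  have := ((Equiv.apply_symm_apply _ _).symm.trans this : (MonoidalCategoryStruct.leftUnitor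
    (C := PresheafOfModules (X.presheaf ⋙ forget₂ CommRingCat RingCat)) M.val).hom = _)
  exact congr(($this).app (op U)
    (TensorProduct.tmul Γ(X, U) (M := Γ(X, U)) (N := Γ(M, U)) a m)).symm

lemma ev_comp {M N : X.Modules} (s : 𝒪 X ⟶ M) (g : M ⟶ N) (U : X.Opens) :
    ev (s ≫ g) U = g.app U (ev s U) := rfl

lemma unit_hom_app {M : X.Modules} (s : 𝒪 X ⟶ M) (U : X.Opens) (a : Γ(X, U)) :
    s.app U a = a • ev s U := by
  have := s.app_smul a (1 : Γ(X, U))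
  refine Eq.trans ?_ this
  exact congr(s.app U $((mul_one a).symm))

lemma ev_sum {M : X.Modules} {ι : Type*} (t : Finset ι) (s : ι → (𝒪 X ⟶ M)) (U : X.Opens) :
    ev (∑ i ∈ t, s i) U = ∑ i ∈ t, ev (s i) U :=
  map_sum (AddMonoidHom.mk' (fun s : 𝒪 X ⟶ M ↦ ev s U) fun _ _ ↦ rfl) s t

/-- Scalars of `k` act on morphisms through global functions, so `a • s` is multiplication by `a` on
`𝒪` followed by `s`. -/
lemma ev_smul {k : Type u} [Field k] [X.Over (Spec (CommRingCat.of k))] {M : X.Modules}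
    (a : k) (s : 𝒪 X ⟶ M) (U : X.Opens) : ev (a • s) U = constants k X U a • ev s U := by
  have h : (a • s) = scalarEnd (constants k X ⊤ a) (𝒪 X) ≫ s := rfl
  have h' : X.presheaf.map (homOfLE (le_top : U ≤ ⊤)).op (constants k X ⊤ a) =
      constants k X U a := by
    unfold constants
    rw [← CommRingCat.comp_apply, Category.assoc, Category.assoc, ← X.presheaf.map_comp]
    rfl
  rw [h]
  change s.app U ((scalarEnd _ (𝒪 X)).app U (1 : Γ(X, U))) = _
  rw [← h']
  exact s.app_smul _ _

/-- A morphism out of `𝒪` is determined by the global section that is the image of `1`, and a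
section of a sheaf is determined on a cover. -/
lemma hom_ext_of_iSup {ι : Type*} {M : X.Modules} (U : ι → X.Opens) (hU : ⨆ i, U i = ⊤)
    {s t : 𝒪 X ⟶ M} (h : ∀ i, ev s (U i) = ev t (U i)) : s = t := by
  have key : ev s ⊤ = ev t ⊤ := by
    refine TopCat.Sheaf.eq_of_locally_eq' (⟨M.presheaf, M.isSheaf⟩ : TopCat.Sheaf Ab X) U ⊤
      (fun i ↦ homOfLE le_top) hU.ge _ _ fun i ↦ ?_
    exact (ev_res s le_top).trans ((h i).trans (ev_res t le_top).symm)
  ext V a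
  change s.app V a = t.app V a
  refine (unit_hom_app s V a).trans (Eq.trans ?_ (unit_hom_app t V a).symm)
  rw [← ev_res s (le_top : V ≤ ⊤), key, ev_res]

/-- The section of `𝒪ⁿ` with given components. -/
def freeSection {n : ℕ} {U : X.Opens} (a : Fin n → Γ(X, U)) : Γ((⨁ fun _ : Fin n ↦ 𝒪 X), U) :=
  ∑ i, (biproduct.ι (fun _ : Fin n ↦ 𝒪 X) i).app U (a i)

lemma desc_freeSection {n : ℕ} {U : X.Opens} (a : Fin n → Γ(X, U)) {M : X.Modules}
    (f : Fin n → (𝒪 X ⟶ M)) :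
    (biproduct.desc f).app U (freeSection a) = ∑ i, a i • ev (f i) U := by
  unfold freeSection
  rw [map_sum]
  refine Finset.sum_congr rfl fun i _ ↦ ?_
  rw [← unit_hom_app, ← biproduct.ι_desc f i]
  rfl

lemma π_freeSection {n : ℕ} {U : X.Opens} (a : Fin n → Γ(X, U)) (i : Fin n) :
    (biproduct.π (fun _ : Fin n ↦ 𝒪 X) i).app U (freeSection a) = a i := by
  unfold freeSection
  rw [map_sum, Finset.sum_eq_single i]
  · change ((biproduct.ι (fun _ : Fin n ↦ 𝒪 X) i) ≫ biproduct.π _ i).app U (a i) = a i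
    rw [biproduct.ι_π_self]
    rfl
  · intro j _ hj
    change ((biproduct.ι (fun _ : Fin n ↦ 𝒪 X) j) ≫ biproduct.π _ i).app U (a j) = 0
    rw [biproduct.ι_π_ne _ hj]
    rfl
  · simp

lemma freeSection_smul {n : ℕ} {U : X.Opens} (b : Γ(X, U)) (a : Fin n → Γ(X, U)) :
    freeSection (fun i ↦ b * a i) = b • freeSection a := by
  unfold freeSection
  rw [Finset.smul_sum]
  exact Finset.sum_congr rfl fun i _ ↦ (biproduct.ι (fun _ : Fin n ↦ 𝒪 X) i).app_smul b (a i)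

lemma app_res {M N : X.Modules} (f : M ⟶ N) {U V : X.Opens} (h : V ≤ U) (m : Γ(M, U)) :
    N.presheaf.map (homOfLE h).op (f.app U m) = f.app V (M.presheaf.map (homOfLE h).op m) :=
  congr($(f.mapPresheaf.naturality (homOfLE h).op) m).symm

lemma freeSection_res {n : ℕ} {U V : X.Opens} (h : V ≤ U) (a : Fin n → Γ(X, U)) :
    (⨁ fun _ : Fin n ↦ 𝒪 X).presheaf.map (homOfLE h).op (freeSection a) =
      freeSection fun i ↦ X.presheaf.map (homOfLE h).op (a i) := by
  unfold freeSection
  rw [map_sum]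
  exact Finset.sum_congr rfl fun i _ ↦ app_res _ h _

/-- Taking sections is left exact, so identities in `F` or in an ideal sheaf may be checked in the
ambient sheaf. -/
lemma kernel_section_ext {M N : X.Modules} (f : M ⟶ N) {U : X.Opens} {y z : Γ(kernel f, U)}
    (h : (kernel.ι f).app U y = (kernel.ι f).app U z) : y = z := by
  have h0 : f.app U ((kernel.ι f).app U z) = 0 := by
    change (kernel.ι f ≫ f).app U z = 0
    rw [kernel.condition]
    rfl
  exact (existsUnique_kernel_section f U _ h0).unique h rfl

lemma ne_zero_of_isNowhereVanishing [Nonempty X] {M : X.Modules} {s : 𝒪 X ⟶ M}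
    (hs : IsNowhereVanishing s) : s ≠ 0 := by
  rintro rfl
  obtain ⟨p⟩ := ‹Nonempty X›
  exact hs p ⟨⊤, trivial, zero_mem _⟩

end Sections

/-! ### Dehomogenised forms on the charts of projective space. -/

section Forms
variable {k : Type u} [Field k]

lemma frac_sum {ι : Type*} (d : ℕ) (j : Fin 7) (t : Finset ι)
    (p : ι → MvPolynomial.homogeneousSubmodule (Fin 7) k d) :
    frac k d j (∑ i ∈ t, p i) = ∑ i ∈ t, frac k d j (p i) :=
  map_sum (AddMonoidHom.mk' (frac k d j) (frac_add d j)) p t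

lemma frac_zero (d : ℕ) (j : Fin 7) : frac k d j 0 = 0 :=
  map_zero (AddMonoidHom.mk' (frac k d j) (frac_add d j))

open MvPolynomial in
lemma frac_mul {d e : ℕ} (j : Fin 7) (p : homogeneousSubmodule (Fin 7) k d)
    (q : homogeneousSubmodule (Fin 7) k e) :
    frac k d j p * frac k e j q =
      frac k (d + e) j ⟨p.1 * q.1, IsHomogeneous.mul p.2 q.2⟩ := by
  unfold frac
  rw [← map_mul]
  congr 1
  apply HomogeneousLocalization.val_injective
  rw [HomogeneousLocalization.val_mul, away_val, away_val, away_val, Localization.mk_mul]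
  congr 1
  exact Subtype.ext (pow_add _ _ _).symm

open MvPolynomial in
-- Reconciles two sources of constants on a chart: forms of degree zero, and functions pulled back
-- along the structure morphism.
lemma frac_constant (j : Fin 7) (a : k) :
    frac k 0 j ⟨C a, isHomogeneous_C _ a⟩ =
      ((Scheme.ΓSpecIso (CommRingCat.of k)).inv ≫ (PP.str k).appTop ≫
        (PP k).presheaf.map (homOfLE le_top : chart k j ⟶ ⊤).op).hom a := by
  set 𝒜 := homogeneousSubmodule (Fin 7) k
  have hX : X j ∈ 𝒜 1 := isHomogeneous_X k j
  let g : CommRingCat.of k ⟶ CommRingCat.of (HomogeneousLocalization.Away 𝒜 (X j)) :=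
    CommRingCat.ofHom (algebraMap k (𝒜 0)) ≫
      CommRingCat.ofHom (HomogeneousLocalization.fromZeroRingHom 𝒜 _)
  -- On the affine chart the structure morphism is `Spec` of the ring map from `k` through degree
  -- zero to the degree-zero localisation at `X_j`.
  have h1 : (chart k j).ι ≫ PP.str k = Proj.basicOpenToSpec 𝒜 (X j) ≫ Spec.map g := by
    have := Proj.awayι_toSpecZero 𝒜 (X j) hX one_pos
    rw [← Proj.basicOpenIsoSpec_inv_ι, Category.assoc, Iso.inv_comp_eq,
      Proj.basicOpenIsoSpec_hom] at this
    unfold PP.str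
    rw [reassoc_of% this, ← Spec.map_comp]
  have h2 : (Scheme.ΓSpecIso (CommRingCat.of k)).inv ≫ (PP.str k).appTop ≫ (chart k j).ι.appTop =
      g ≫ Proj.awayToSection 𝒜 (X j) ≫ (chart k j).topIso.inv := by
    have h3 := congr(($h1).appTop)
    rw [Scheme.Hom.comp_appTop, Scheme.Hom.comp_appTop] at h3
    rw [h3]
    have h4 : (Proj.basicOpenToSpec 𝒜 (X j)).appTop = _ := Proj.basicOpenToSpec_app_top 𝒜 (X j)
    have h5 := Scheme.ΓSpecIso_inv_naturality g
    rw [← reassoc_of% h5, h4, Iso.inv_hom_id_assoc]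
  have h6 : (chart k j).ι.appTop ≫ (chart k j).topIso.hom =
      (PP k).presheaf.map (homOfLE le_top : chart k j ⟶ ⊤).op := by
    simp
    rfl
  rw [← h6, ← Category.assoc, ← Category.assoc, Category.assoc _ (PP.str k).appTop, h2]
  simp
  rfl

end Forms
-- From linear syzygies of quadrics to sections of `F(L)`, and their pairing with the extension.
section Syzygy
variable {k : Type u} [Field k] {C : Scheme.{u}}

/-- The linear form attached to `σ`, as a form of degree one. -/
abbrev linearForm₁ [C.Over (Spec (CommRingCat.of k))] {L : C.Modules}
    (x : Module.Basis (Fin 7) k (𝒪 C ⟶ L)) (σ : 𝒪 C ⟶ L) :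
    MvPolynomial.homogeneousSubmodule (Fin 7) k 1 :=
  ∑ l, x.repr σ l • coord l

lemma coe_linearForm₁ [C.Over (Spec (CommRingCat.of k))] {L : C.Modules}
    (x : Module.Basis (Fin 7) k (𝒪 C ⟶ L)) (σ : 𝒪 C ⟶ L) :
    (linearForm₁ x σ : MvPolynomial (Fin 7) k) = linearForm x σ := by
  simp [linearForm₁, linearForm]

/-- Since `φ` is a morphism over `k`, it pulls constants back to constants. -/
lemma app_frac_constant [C.Over (Spec (CommRingCat.of k))] {φ : C ⟶ PP k}
    (h : φ ≫ PP.str k = C ↘ Spec (CommRingCat.of k)) (j : Fin 7) (a : k) :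
    (φ.app (chart k j) (frac k 0 j ⟨MvPolynomial.C a, MvPolynomial.isHomogeneous_C _ a⟩) :
      Γ(C, φ ⁻¹ᵁ chart k j)) = constants k C _ a := by
  rw [frac_constant]
  unfold constants
  have h' := congr(($h).appTop)
  rw [Scheme.Hom.comp_appTop] at h'
  rw [← h', ← ConcreteCategory.comp_apply]
  simp only [Category.assoc, Scheme.Hom.naturality]
  rfl

/-- A section of `L` is, on the chart `X_j ≠ 0`, the multiple of `x_j` by the dehomogenisation of its
linear form. -/
lemma ev_eq_frac_smul [C.Over (Spec (CommRingCat.of k))] {L : C.Modules}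
    {x : Module.Basis (Fin 7) k (𝒪 C ⟶ L)} {φ : C ⟶ PP k} (h : IsLinearSystemMap x φ)
    (σ : 𝒪 C ⟶ L) (j : Fin 7) :
    ev σ (φ ⁻¹ᵁ chart k j) =
      (φ.app (chart k j) (frac k 1 j (linearForm₁ x σ)) : Γ(C, φ ⁻¹ᵁ chart k j)) • ev (x j) _ := by
  conv_lhs => rw [← x.sum_repr σ]
  rw [ev_sum, frac_sum, map_sum, Finset.sum_smul]
  refine Finset.sum_congr rfl fun l _ ↦ ?_
  rw [ev_smul, h.ratio j l, smul_smul, frac_smul, map_mul, app_frac_constant h.comp_str]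

/-- The differential of a syzygy vanishes: if `∑ aᵢ fᵢ = 0` with `fᵢ` vanishing along `φ`, then
`∑ aᵢ dfᵢ = 0` in the conormal sheaf. -/
lemma sum_smul_conormalClass {X Y : Scheme.{u}} (φ : X ⟶ Y) {n : ℕ} (U : Y.Opens)
    (a f : Fin n → Γ(Y, U)) (hf : ∀ i, φ.app U (f i) = 0) (haf : ∑ i, a i * f i = 0) :
    ∑ i, (φ.app U (a i) : Γ(X, φ ⁻¹ᵁ U)) • conormalClass φ U (f i) (hf i) = 0 := by
  -- The relation already holds in the ideal sheaf, which injects into `𝒪_Y`; its image in the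
  -- conormal sheaf follows by linearity.
  have h0 : ∑ i, a i • idealSheafSection φ U (f i) (hf i) = 0 := by
    refine kernel_section_ext (unitToPushforward φ) ?_
    refine (map_sum ((idealSheafι φ).app U).hom _ _).trans
      (Eq.trans ?_ (haf.trans (map_zero ((idealSheafι φ).app U).hom).symm))
    refine Finset.sum_congr rfl fun i _ ↦ ?_
    exact ((idealSheafι φ).app_smul (a i) _).trans
      (congr_arg (a i • ·) (idealSheafSection_spec φ U (f i) (hf i)))
  have := congr_arg (((Scheme.Modules.pullbackPushforwardAdjunction φ).unit.app
    (idealSheaf φ)).app U) h0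
  rw [map_zero, map_sum] at this
  refine Eq.trans (Finset.sum_congr rfl fun i _ ↦ ?_) this
  rw [Scheme.Modules.Hom.app_smul]
  rfl

lemma sum_tmul {X : Scheme.{u}} {M N : X.Modules} {U : X.Opens} {n : ℕ} (m : Fin n → Γ(M, U))
    (y : Γ(N, U)) : ∑ i, tmul (m i) y = tmul (∑ i, m i) y :=
  map_sum (AddMonoidHom.mk' (fun m : Γ(M, U) ↦ tmul m y) fun m m' ↦ by
    unfold tmul
    exact (congr_arg _ (TensorProduct.add_tmul (R := Γ(X, U)) (M := Γ(M, U)) (N := Γ(N, U)) m m' y)).trans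
      (map_add _ _ _)) m Finset.univ |>.symm

lemma zero_tmul {X : Scheme.{u}} {M N : X.Modules} {U : X.Opens} (y : Γ(N, U)) :
    tmul (0 : Γ(M, U)) y = 0 := by
  simpa using (sum_tmul (M := M) (n := 0) Fin.elim0 y).symm

variable [C.Over (Spec (CommRingCat.of k))] {L : C.Modules}
  {x : Module.Basis (Fin 7) k (𝒪 C ⟶ L)} {φ : C ⟶ PP k}

/-- The syzygy is a relation between cubic forms; dividing it by `X_j³` gives the relation on the
chart. -/
lemma sum_frac_mul_equation {n : ℕ} (q : Fin n → vanishingForms φ 2)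
    (ℓ : Fin n → (𝒪 C ⟶ L))
    (hℓ : ∑ i, linearForm x (ℓ i) * (q i : MvPolynomial (Fin 7) k) = 0) (j : Fin 7) :
    ∑ i, frac k 1 j (linearForm₁ x (ℓ i)) * equation (q i) j = 0 := by
  unfold equation
  simp only [frac_mul]
  rw [← frac_sum, ← frac_zero 3 j]
  congr 1
  apply Subtype.ext
  rw [AddSubmonoidClass.coe_finsetSum]
  simp only [coe_linearForm₁]
  exact hℓ

/-- A linear syzygy between the quadrics through `C` comes from a global section of `F(L)`. -/
lemma exists_section_of_syzygy (h : IsLinearSystemMap x φ) {n : ℕ} (q : Fin n → vanishingForms φ 2)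
    (ℓ : Fin n → (𝒪 C ⟶ L))
    (hℓ : ∑ i, linearForm x (ℓ i) * (q i : MvPolynomial (Fin 7) k) = 0) :
    ∃ t : 𝒪 C ⟶ tensorObj (bundleF h q) L, ∀ i, component h q t i = ℓ i := by
  -- The ratio `ℓ_i / x_j` on the chart `X_j ≠ 0`.
  let a (j : Fin 7) (i : Fin n) : Γ(C, φ ⁻¹ᵁ chart k j) :=
    φ.app (chart k j) (frac k 1 j (linearForm₁ x (ℓ i)))
  have ha (j i) : ev (ℓ i) (φ ⁻¹ᵁ chart k j) = a j i • ev (x j) _ := ev_eq_frac_smul h (ℓ i) j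
  have hker (j : Fin 7) : (differentiation h q).app (φ ⁻¹ᵁ chart k j) (freeSection (a j)) = 0 := by
    unfold differentiation
    rw [desc_freeSection]
    simp only [conormalDiff_spec, localDiff]
    have := sum_smul_conormalClass φ (chart k j) (fun i ↦ frac k 1 j (linearForm₁ x (ℓ i)))
      (fun i ↦ equation (q i) j) (fun i ↦ app_equation (q i) j)
      (sum_frac_mul_equation q ℓ hℓ j)
    refine Eq.trans (Finset.sum_congr rfl fun i _ ↦ (smul_tmul' _ _ _).symm) ?_
    refine (sum_tmul _ _).trans ?_
    exact (congrArg (tmul · _) this).trans (zero_tmul _)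
  choose t ht using fun j ↦ (existsUnique_kernel_section (differentiation h q) _ _ (hker j)).exists
  have hcover : ⨆ j, φ ⁻¹ᵁ chart k j = ⊤ := by
    rw [← Scheme.Hom.preimage_iSup, iSup_chart]
    rfl
  -- With `t_j` the section of `F` with coordinates `ℓ_i / x_j`, the product `t_j ⊗ x_j` does not
  -- depend on the chart.
  obtain ⟨s, hs⟩ := exists_glue (tensorObj (bundleF h q) L) (fun j ↦ φ ⁻¹ᵁ chart k j) hcover
    (fun j ↦ tmul (M := bundleF h q) (t j) (ev (x j) _)) (by
      intro j m
      set V : C.Opens := φ ⁻¹ᵁ chart k j ⊓ φ ⁻¹ᵁ chart k m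
      have hj : V ≤ φ ⁻¹ᵁ chart k j := inf_le_left
      have hm : V ≤ φ ⁻¹ᵁ chart k m := inf_le_right
      obtain ⟨b, hb⟩ : ∃ b : Γ(C, V), ev (x m) V = b • ev (x j) V := by
        have := congr_arg (L.presheaf.map (homOfLE hj).op) (h.ratio j m)
        rw [Scheme.Modules.map_smul, ev_res, ev_res] at this
        exact ⟨_, this⟩
      -- With `b = x_m / x_j`, both sides times `x_j` equal `ℓ_i`, and the generator `x_j` can be
      -- cancelled.
      have hab (i : Fin n) : C.presheaf.map (homOfLE hj).op (a j i) =
          b * C.presheaf.map (homOfLE hm).op (a m i) := by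
        have h1 := congr_arg (L.presheaf.map (homOfLE hj).op) (ha j i)
        have h2 := congr_arg (L.presheaf.map (homOfLE hm).op) (ha m i)
        rw [Scheme.Modules.map_smul, ev_res, ev_res] at h1 h2
        rw [hb, smul_smul] at h2
        apply (h.isGenerator j V (homOfLE hj)).1
        change _ • L.presheaf.map (homOfLE hj).op _ = _ • L.presheaf.map (homOfLE hj).op _
        rw [ev_res, ← h1, h2, mul_comm]
      have htb : (bundleF h q).presheaf.map (homOfLE hj).op (t j) =
          b • (bundleF h q).presheaf.map (homOfLE hm).op (t m) := by
        refine kernel_section_ext (differentiation h q) ?_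
        refine Eq.trans ?_ ((kernel.ι (differentiation h q)).app_smul b _).symm
        refine (app_res (kernel.ι (differentiation h q)) hj (t j)).symm.trans ?_
        refine Eq.trans ?_
          (congr_arg (b • ·) (app_res (kernel.ι (differentiation h q)) hm (t m)))
        dsimp only
        rw [ht, ht, freeSection_res, freeSection_res, ← freeSection_smul]
        congr 1
        exact funext hab
      change (tensorObj (bundleF h q) L).presheaf.map (homOfLE hj).op _ =
        (tensorObj (bundleF h q) L).presheaf.map (homOfLE hm).op _
      refine (tmul_res (M := bundleF h q) (homOfLE hj) (t j) _).trans
        (Eq.trans ?_ (tmul_res (M := bundleF h q) (homOfLE hm) (t m) _).symm)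
      -- The factor `b` moves across the tensor sign: `(b t_m) ⊗ x_j = t_m ⊗ (b x_j)`.
      rw [ev_res, ev_res, htb, hb, smul_tmul])
  refine ⟨s, fun i ↦ hom_ext_of_iSup _ hcover fun j ↦ ?_⟩
  unfold component
  rw [ev_comp, Scheme.Modules.Hom.comp_app, ConcreteCategory.comp_apply, hs, ha]
  have hπ : (kernel.ι (differentiation h q) ≫ biproduct.π _ i).app (φ ⁻¹ᵁ chart k j) (t j) =
      a j i := by
    rw [Scheme.Modules.Hom.comp_app, ConcreteCategory.comp_apply, ht, π_freeSection]
  refine (congr_arg ((unitTensor L).app _) (tensorMap_tmul (M := bundleF h q)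
    (kernel.ι (differentiation h q) ≫ biproduct.π _ i) (𝟙 L) (t j) _)).trans ?_
  exact (congr_arg (fun z ↦ (unitTensor L).app _ (tmul z _)) hπ).trans (unitTensor_tmul L _ _)

lemma component_smul (h : IsLinearSystemMap x φ) {n : ℕ} (q : Fin n → vanishingForms φ 2)
    (a : k) (s : 𝒪 C ⟶ tensorObj (bundleF h q) L) (i : Fin n) :
    component h q (a • s) i = a • component h q s i := by
  unfold component
  rw [Linear.smul_comp]

/-- The functional attached to an extension by `s` kills every section of `L` that factors
through `s`. -/
lemma serrePairing_extClass_comp {A E M : C.Modules} (tr : Abelian.Ext A M 1 →ₗ[k] k)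
    {s : 𝒪 C ⟶ E} {π : E ⟶ A} {w : s ≫ π = 0} (hex : (ShortComplex.mk s π w).ShortExact)
    (g : E ⟶ M) : serrePairing tr hex.extClass (s ≫ g) = 0 := by
  change tr (hex.extClass.comp (Abelian.Ext.mk₀ (s ≫ g)) (add_zero 1)) = 0
  -- Reassociates the product so that the class of the extension meets `s` first; that composite is
  -- zero.
  rw [← Abelian.Ext.mk₀_comp_mk₀]
  have := hex.extClass_comp_assoc (Abelian.Ext.mk₀ g) (h := add_zero 1)
  refine (congr_arg tr ?_).trans (map_zero tr)
  exact this

end Syzygy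

/-! ### Linear algebra: forms vanishing on a hyperplane. -/

/-- Two linear forms that vanish on a hyperplane are proportional. -/
lemma exists_eq_smul_of_finrank_span {k V : Type*} [Field k] [AddCommGroup V] [Module k V] {ι : Type*}
    (v : ι → V) [FiniteDimensional k V]
    (hv : Module.finrank k V = Module.finrank k (Submodule.span k (Set.range v)) + 1)
    {f g : V →ₗ[k] k} (hf : f ≠ 0) (hfv : ∀ i, f (v i) = 0) (hgv : ∀ i, g (v i) = 0) :
    ∃ c : k, g = c • f := by
  have hle {g : V →ₗ[k] k} (hg : ∀ i, g (v i) = 0) :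
      Submodule.span k (Set.range v) ≤ LinearMap.ker g :=
    Submodule.span_le.2 (by rintro _ ⟨i, rfl⟩; exact hg i)
  have hk : Module.finrank k (LinearMap.ker f) + 1 = Module.finrank k V :=
    Module.Dual.finrank_ker_add_one_of_ne_zero hf
  -- The span lies in `ker f` and both have codimension one, so they coincide.
  have heq := Submodule.eq_of_le_of_finrank_eq (hle hfv) (by omega)
  have hker : LinearMap.ker f ≤ LinearMap.ker g := heq ▸ hle hgv
  obtain ⟨v₀, hv₀⟩ : ∃ v₀, f v₀ ≠ 0 := by
    by_contra! H
    exact hf (LinearMap.ext H)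
  refine ⟨g v₀ / f v₀, LinearMap.ext fun y ↦ ?_⟩
  have : y - (f y / f v₀) • v₀ ∈ LinearMap.ker g := hker (by simp [hv₀])
  rw [LinearMap.mem_ker, map_sub, map_smul, sub_eq_zero] at this
  rw [this, LinearMap.smul_apply, smul_eq_mul, smul_eq_mul]
  ring

end PrymSyzygy
end

theorem mainTheorem8 {k : Type u} [Field k] [IsAlgClosed k] [CharZero k]
    (C : Scheme.{u}) [C.Over (Spec (CommRingCat.of k))]
    [AlgebraicGeometry.IsIntegral C]
    [IsProper (C ↘ Spec (CommRingCat.of k))]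
    [SmoothOfRelativeDimension 1 (C ↘ Spec (CommRingCat.of k))]
    (genus : Module.finrank k (𝒪 C ⟶ Omega k C) = 8)
    (η : C.Modules) (hη : IsLineBundle η)
    (hη₂ : Nonempty (tensorObj η η ≅ 𝒪 C)) (hη₀ : ¬ Nonempty (η ≅ 𝒪 C))
    (x : Module.Basis (Fin 7) k (𝒪 C ⟶ tensorObj (Omega k C) η))
    (φ : C ⟶ PP k) (hφ : IsLinearSystemMap x φ) [IsClosedImmersion φ]
    (hquad : IsCutOutByQuadrics φ)
    {n : ℕ} (q : Module.Basis (Fin n) k (vanishingForms φ 2))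
    (s : 𝒪 C ⟶ tensorObj (bundleF hφ q) (tensorObj (Omega k C) η))
    (hs : IsNowhereVanishing s)
    (π : tensorObj (bundleF hφ q) (tensorObj (Omega k C) η) ⟶ η) (w : s ≫ π = 0)
    (hex : (ShortComplex.mk s π w).ShortExact)
    (tr : Abelian.Ext η (tensorObj (Omega k C) η) 1 →ₗ[k] k)
    (ℓ : Fin n → (𝒪 C ⟶ tensorObj (Omega k C) η))
    (hℓ : ∑ i, linearForm x (ℓ i) * (q i : MvPolynomial (Fin 7) k) = 0)
    (hrank : Module.finrank k (Submodule.span k (Set.range ℓ)) = 6)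
    (hlink : Module.finrank k (𝒪 C ⟶ tensorObj (bundleF hφ q) (tensorObj (Omega k C) η)) = 1 ∨
      ∃ a : k, ∀ i, ℓ i = a • component hφ q s i)
    (f : (𝒪 C ⟶ tensorObj (Omega k C) η) →ₗ[k] k) (hf : f ≠ 0) (hfℓ : ∀ i, f (ℓ i) = 0) :
    ∃ c : k, serrePairing tr hex.extClass = c • f := by
  have hC : Nonempty C := inferInstance
  -- Both alternatives of the link reduce to the second: if `h⁰(F(L)) = 1`, the section realising
  -- the syzygy is a multiple of the nonzero section `s`.
  have hcomp : ∃ a : k, ∀ i, ℓ i = a • component hφ q s i := by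
    refine hlink.elim (fun h1 ↦ ?_) id
    obtain ⟨t, ht⟩ := exists_section_of_syzygy hφ q ℓ hℓ
    obtain ⟨a, rfl⟩ := (finrank_eq_one_iff_of_nonzero' s (ne_zero_of_isNowhereVanishing hs)).1 h1 t
    exact ⟨a, fun i ↦ (ht i).symm.trans (component_smul hφ q a s i)⟩
  obtain ⟨a, ha⟩ := hcomp
  have : FiniteDimensional k (𝒪 C ⟶ tensorObj (Omega k C) η) := x.finiteDimensional_of_finite
  refine exists_eq_smul_of_finrank_span ℓ ?_ hf hfℓ fun i ↦ ?_
  -- The span is a hyperplane: `7 = 6 + 1`.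
  · rw [hrank, Module.finrank_eq_card_basis x, Fintype.card_fin]
  · rw [ha, map_smul, component, serrePairing_extClass_comp, smul_zero]
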